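/- \textbf{Setting.} Let $G$ be a finite connected undirected simple graph with a positive real length on each edge, and let $s$ be a start vertex. A \emph{tour} is a closed walk from $s$ that visits every vertex; its length is the sum of the lengths of the edges it traverses, counted with multiplicity, and $\mathrm{OPT}(G,s)$ is the minimum length of a tour. In online graph exploration an edge becomes known once one of its endpoints has been visited. The algorithm \emph{Nearest Neighbor} (NN) starts at $s$ and repeatedly walks, along a shortest walk of known edges, to a nearest unvisited vertex; when all vertices have been visited it returns to $s$ along a shortest path. Ties are broken adversarially, so a \emph{NN tour} is any tour that can arise in this way for some choice among nearest vertices. NN is \emph{$c$-competitive on trees with $n$ vertices} if for every tree $G$ with $n$ vertices and positive edge lengths and every start vertex $s$, every NN tour has length at most $c\cdot\mathrm{OPT}(G,s)$. The \emph{competitive ratio} $R(n)$ of NN on trees with $n$ vertices is the infimum of all $c\ge 0$ with this property. \textbf{The trees $G_k$.} $G_0$ is a single vertex $l_0=r_0$. For $k\ge 1$, $G_k$ consists of two disjoint copies $G_{k-1}'$, $G_{k-1}''$ of $G_{k-1}$ and a new vertex $m_k$, together with an edge of length $k$ between $r_{k-1}'$ and $l_{k-1}''$ and an edge of length $1$ between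 $l_{k-1}''$ and $m_k$; put $l_k=l_{k-1}'$ and $r_k=r_{k-1}''$. (So $G_1$ is the path $l_1r_1m_1$ with two edges of length $1$.) \textbf{Theorem.} The competitive ratio of NN on trees with $n$ vertices is $\Theta(\log n)$: there are constants $c,C>0$ such that $c\log n\le R(n)\le C\log n$ for all $n\ge 2$. Moreover, for every $k\ge 1$, $G_k$ is a tree with $2^{k+1}-1$ vertices, there is a NN tour of $G_k$ from $l_k$ of length $(k+2)2^k-2$, and $\mathrm{OPT}(G_k,l_k)=6\cdot 2^k-2k-6$. -/

import Mathlib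

/-- A weighted undirected (simple) graph: every edge has a positive real length. Values of `weight`
on non-adjacent pairs carry no meaning. -/
structure WeightedGraph (V : Type) extends SimpleGraph V where
  weight : V → V → ℝ
  weight_symm : ∀ u v, weight u v = weight v u
  weight_pos : ∀ u v, Adj u v → 0 < weight u v

namespace WeightedGraph

variable {V : Type} (G : WeightedGraph V)

/-- The length of a walk: the sum of the lengths of the edges it traverses, with multiplicity. -/
def length {u v : V} (p : G.toSimpleGraph.Walk u v) : ℝ :=
  (p.darts.map fun d => G.weight d.fst d.snd).sum

/-- A tour from `s`: a closed walk starting and ending in `s` that visits every vertex. -/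
def IsTour {s : V} (p : G.toSimpleGraph.Walk s s) : Prop :=
  ∀ v, v ∈ p.support

/-- The length of an optimal (offline) tour from `s`. -/
noncomputable def opt (s : V) : ℝ :=
  sInf {L : ℝ | ∃ p : G.toSimpleGraph.Walk s s, G.IsTour p ∧ G.length p = L}

/-- A walk inside the part of the graph that is known once exactly the vertices in `S` have been
visited: an edge is known if and only if at least one of its endpoints has been visited. -/
def IsKnown (S : Set V) {u v : V} (p : G.toSimpleGraph.Walk u v) : Prop :=
  ∀ d ∈ p.darts, d.fst ∈ S ∨ d.snd ∈ S

/-- One step of Nearest Neighbor, with visited set `S` and current position `v`: walk along `p`,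
a shortest walk among all known walks from `v` to unvisited vertices. -/
def IsNearestStep (S : Set V) {v u : V} (p : G.toSimpleGraph.Walk v u) : Prop :=
  u ∉ S ∧ G.IsKnown S p ∧
    ∀ (u' : V) (p' : G.toSimpleGraph.Walk v u'),
      u' ∉ S → G.IsKnown S p' → G.length p ≤ G.length p'

/-- `G.NNRun S p T`: starting at the first vertex of `p` with visited set `S`, some finite number
of Nearest Neighbor steps moves the searcher along `p` and leaves it with visited set `T`.
Ties between nearest vertices may be broken arbitrarily. -/
inductive NNRun : Set V → {v x : V} → G.toSimpleGraph.Walk v x → Set V → Prop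
  | done (S : Set V) (v : V) : NNRun S (SimpleGraph.Walk.nil : G.toSimpleGraph.Walk v v) S
  | step {S T : Set V} {v u x : V} (p : G.toSimpleGraph.Walk v u) (q : G.toSimpleGraph.Walk u x) :
      G.IsNearestStep S p → NNRun (insert u S) q T → NNRun S (p.append q) T

/-- A tour that Nearest Neighbor may take from `s`: Nearest Neighbor steps until all vertices are
visited, then a shortest walk back to `s`. -/
def IsNNTour {s : V} (t : G.toSimpleGraph.Walk s s) : Prop :=
  ∃ (x : V) (q : G.toSimpleGraph.Walk s x) (b : G.toSimpleGraph.Walk x s),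
    G.NNRun {s} q Set.univ ∧ (∀ b' : G.toSimpleGraph.Walk x s, G.length b ≤ G.length b') ∧
      t = q.append b

end WeightedGraph

/-- Nearest Neighbor is `c`-competitive on trees with `n` vertices: on every weighted tree with `n`
vertices, for every start vertex and all ways of breaking ties, its tour is at most `c` times as
long as an optimal tour. -/
def NNCompetitiveOnTrees (n : ℕ) (c : ENNReal) : Prop :=
  ∀ (V : Type) [Finite V] (G : WeightedGraph V), Nat.card V = n → G.toSimpleGraph.IsTree →
    ∀ (s : V) (t : G.toSimpleGraph.Walk s s), G.IsNNTour t →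
      ENNReal.ofReal (G.length t) ≤ c * ENNReal.ofReal (G.opt s)

/-- The competitive ratio of Nearest Neighbor on trees with `n` vertices. -/
noncomputable def nnCompetitiveRatioOnTrees (n : ℕ) : ENNReal :=
  sInf {c : ENNReal | NNCompetitiveOnTrees n c}

/-- Vertices of the spiked path `G_k`: `G_0` is a single vertex, and `G_(k+1)` has the vertices of
two copies of `G_k` and one new vertex `mid`. -/
inductive SpikedVertex : ℕ → Type
  | base : SpikedVertex 0
  | left {k : ℕ} (v : SpikedVertex k) : SpikedVertex (k + 1)
  | right {k : ℕ} (v : SpikedVertex k) : SpikedVertex (k + 1)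
  | mid {k : ℕ} : SpikedVertex (k + 1)

namespace SpikedVertex

/-- The vertex `l_k`. -/
def l : (k : ℕ) → SpikedVertex k
  | 0 => base
  | k + 1 => left (l k)

/-- The vertex `r_k`. -/
def r : (k : ℕ) → SpikedVertex k
  | 0 => base
  | k + 1 => right (r k)

open Classical in
/-- The edge lengths of `G_k`, with `0` for "no edge": `G_(k+1)` consists of the edges of its two
copies of `G_k`, an edge of length `k + 1` between `r_k` of the left copy and `l_k` of the right
copy, and an edge of length `1` between `l_k` of the right copy and the new vertex. -/
noncomputable def edgeLength : {k : ℕ} → SpikedVertex k → SpikedVertex k → ℝ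
  | _, base, base => 0
  | _, left u, left v => edgeLength u v
  | _, right u, right v => edgeLength u v
  | k + 1, left u, right v => if u = r k ∧ v = l k then (k : ℝ) + 1 else 0
  | k + 1, right v, left u => if u = r k ∧ v = l k then (k : ℝ) + 1 else 0
  | k + 1, right v, mid => if v = l k then 1 else 0
  | k + 1, mid, right v => if v = l k then 1 else 0
  | _, left _, mid => 0
  | _, mid, left _ => 0
  | _, mid, mid => 0

theorem edgeLength_symm {k : ℕ} (u v : SpikedVertex k) : edgeLength u v = edgeLength v u := by
  induction k with
  | zero => cases u; cases v; rfl
  | succ k ih => cases u <;> cases v <;> simp [edgeLength, ih]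

theorem edgeLength_self {k : ℕ} (u : SpikedVertex k) : edgeLength u u = 0 := by
  induction k with
  | zero => cases u; simp [edgeLength]
  | succ k ih => cases u <;> simp [edgeLength, ih]

end SpikedVertex

/-- The weighted graph `G_k`. -/
noncomputable def spikedPath (k : ℕ) : WeightedGraph (SpikedVertex k) where
  Adj u v := 0 < SpikedVertex.edgeLength u v
  symm := ⟨fun u v h => by rwa [SpikedVertex.edgeLength_symm v u]⟩
  loopless := ⟨fun u h => by simp [SpikedVertex.edgeLength_self] at h⟩
  weight := SpikedVertex.edgeLength
  weight_symm := SpikedVertex.edgeLength_symm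
  weight_pos _ _ h := h

/-!
On trees with `n` vertices, Nearest Neighbor (NN) loses a factor of order `log n`.

**Upper bound** (valid on every finite graph). Fix a tour of length `L`. When NN makes a step of
length at least `t` from a vertex `a`, all vertices not yet visited have distance at least `t` from
`a`. So the starts of the steps of length at least `t`, together with the last vertex of the run,
have mutual distances at least `t`, and the tour, which visits all of them, shows that there are at
most `L / t` such steps (`NNRun.exists_steps`, `IsTour.card_mul_le`). Hence the `j`-th longest step
has length at most `L / j`, and the run has length at most `L` times a harmonic number
(`Finset.sum_le_mul_harmonic`); the way back costs at most `L`.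

**NN on `G_k`.** The metric of `G_k` is given by a recursion (`SpikedVertex.dist`). The bad run
explores the first copy of `G_(k-1)`, ending in its spike, returns along it to the second copy,
explores that one in the same way, and then has to return for the spike `m_k`. The balance
`dist_last_r_add` says that at the end of each exploration the best alternative is no nearer than
the vertex to which the run proceeds; the induction `exists_nnRun` treats `G_k` as a part of a
larger graph whose other unvisited vertices are not too near to `l_k` and `r_k`.

**Optimal tours of `G_k`.** A tour of `G_(k+1)` retracts to tours of both copies of `G_k`, and it
crosses the two other edges at least twice (`le_sum_edgeLength`); conversely, tours of the copies
combine to a tour that crosses them exactly twice (`exists_isTour`).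

**Lower bound for all `n`.** A path of edges of length `1` in front of the start vertex increases
the lengths of the NN tour and of the offline tour by the same amount, two per vertex. Filling up
the largest `G_k` that has at most `n` vertices in this way keeps the offline tour at `O(2 ^ k)`,
whereas the NN tour has length at least `(k + 1) * 2 ^ k`.
-/

open SimpleGraph

namespace WeightedGraph

/-! ### Walk lengths -/

section Length

variable {V : Type} {G : WeightedGraph V}

@[simp] theorem length_nil {u : V} : G.length (Walk.nil : G.toSimpleGraph.Walk u u) = 0 := by
  simp [length]

@[simp] theorem length_cons {u v w : V} (h : G.Adj u v) (p : G.toSimpleGraph.Walk v w) :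
    G.length (Walk.cons h p) = G.weight u v + G.length p := by
  simp [length]

@[simp] theorem length_append {u v w : V} (p : G.toSimpleGraph.Walk u v)
    (q : G.toSimpleGraph.Walk v w) : G.length (p.append q) = G.length p + G.length q := by
  simp [length]

@[simp] theorem length_reverse {u v : V} (p : G.toSimpleGraph.Walk u v) :
    G.length p.reverse = G.length p := by
  induction p with
  | nil => simp
  | cons h p ih => simp [ih, G.weight_symm, add_comm]

theorem length_nonneg {u v : V} (p : G.toSimpleGraph.Walk u v) : 0 ≤ G.length p := by
  induction p with
  | nil => simp
  | cons h p ih => rw [length_cons]; linarith [G.weight_pos _ _ h]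

theorem length_map {W : Type} {H : WeightedGraph W} (f : G.toSimpleGraph →g H.toSimpleGraph)
    (hf : ∀ u v, G.Adj u v → H.weight (f u) (f v) = G.weight u v) {u v : V}
    (p : G.toSimpleGraph.Walk u v) : H.length (p.map f) = G.length p := by
  induction p with
  | nil => simp
  | cons h p ih => simp [ih, hf _ _ h]

theorem length_eq_add_of_mem_support [DecidableEq V] {u v x : V} (p : G.toSimpleGraph.Walk u v)
    (hx : x ∈ p.support) :
    G.length p = G.length (p.takeUntil x hx) + G.length (p.dropUntil x hx) := by
  rw [← length_append, Walk.take_spec]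

end Length

/-! ### Nearest Neighbor steps and distances in the whole graph -/

section Steps

variable {V : Type} {G : WeightedGraph V} {S : Set V}

theorem exists_isKnown_length_le {v u : V} (q : G.toSimpleGraph.Walk v u) (hv : v ∈ S)
    (hu : u ∉ S) : ∃ (w : V) (q' : G.toSimpleGraph.Walk v w),
      w ∉ S ∧ G.IsKnown S q' ∧ G.length q' ≤ G.length q := by
  induction q with
  | nil => exact absurd hv hu
  | @cons a b c h q ih =>
    by_cases hb : b ∈ S
    · obtain ⟨w, q', hw, hk, hl⟩ := ih hb hu
      refine ⟨w, Walk.cons h q', hw, ?_, by simpa using hl⟩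
      intro d hd
      rw [Walk.darts_cons, List.mem_cons] at hd
      rcases hd with rfl | hd
      · exact Or.inl hv
      · exact hk d hd
    · refine ⟨b, Walk.cons h Walk.nil, hb, ?_, ?_⟩
      · intro d hd
        simp only [Walk.darts_cons, Walk.darts_nil, List.mem_singleton] at hd
        subst hd
        exact Or.inl hv
      · simpa using length_nonneg q

/-- A Nearest Neighbor step is no longer than any walk to an unvisited vertex, known or not: the
part of such a walk up to its first unvisited vertex is known. -/
theorem IsNearestStep.length_le {v u : V} {p : G.toSimpleGraph.Walk v u}
    (hp : G.IsNearestStep S p) (hv : v ∈ S) {u' : V} (hu' : u' ∉ S)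
    (q : G.toSimpleGraph.Walk v u') : G.length p ≤ G.length q := by
  obtain ⟨w, q', hw, hk, hl⟩ := exists_isKnown_length_le q hv hu'
  exact (hp.2.2 w q' hw hk).trans hl

theorem isKnown_of_forall_length_le {v u : V} (p : G.toSimpleGraph.Walk v u)
    (h : ∀ u', u' ∉ S → ∀ q : G.toSimpleGraph.Walk v u', G.length p ≤ G.length q) :
    G.IsKnown S p := by
  induction p with
  | nil => intro d hd; simp at hd
  | @cons a b c hab p ih =>
    intro d hd
    rw [Walk.darts_cons, List.mem_cons] at hd
    rcases hd with rfl | hd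
    · left
      by_contra ha
      have := h a ha Walk.nil
      rw [length_cons, length_nil] at this
      linarith [G.weight_pos _ _ hab, length_nonneg p]
    · refine ih (fun u' hu' q => ?_) d hd
      have := h u' hu' (Walk.cons hab q)
      rw [length_cons, length_cons] at this
      linarith

/-- A shortest walk to a nearest unvisited vertex of the whole graph is a Nearest Neighbor step:
all its vertices but the last are visited, so it is known. -/
theorem isNearestStep_of_forall_length_le {v u : V} (p : G.toSimpleGraph.Walk v u) (hu : u ∉ S)
    (h : ∀ u', u' ∉ S → ∀ q : G.toSimpleGraph.Walk v u', G.length p ≤ G.length q) :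
    G.IsNearestStep S p :=
  ⟨hu, isKnown_of_forall_length_le p h, fun u' q hu' _ => h u' hu' q⟩

theorem NNRun.trans {S T U : Set V} {v x y : V} {p : G.toSimpleGraph.Walk v x}
    {q : G.toSimpleGraph.Walk x y} (hp : G.NNRun S p T) (hq : G.NNRun T q U) :
    G.NNRun S (p.append q) U := by
  induction hp with
  | done S v => simpa using hq
  | step p p' hs _ ih => rw [← Walk.append_assoc]; exact NNRun.step _ _ hs (ih hq)

theorem NNRun.subset_union_support {S T : Set V} {v x : V} {q : G.toSimpleGraph.Walk v x}
    (hq : G.NNRun S q T) : T ⊆ S ∪ {w | w ∈ q.support} := by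
  induction hq with
  | done S v => exact Set.subset_union_left
  | step p q hs _ ih =>
    intro w hw
    rcases ih hw with (rfl | h) | h
    · exact Or.inr (by simp [Walk.mem_support_append_iff])
    · exact Or.inl h
    · exact Or.inr (by
        simp only [Set.mem_ofPred_eq, Walk.mem_support_append_iff] at h ⊢
        exact Or.inr h)

theorem IsNNTour.isTour {s : V} {t : G.toSimpleGraph.Walk s s} (ht : G.IsNNTour t) :
    G.IsTour t := by
  obtain ⟨x, q, b, hq, -, rfl⟩ := ht
  intro v
  rw [Walk.mem_support_append_iff]
  rcases hq.subset_union_support (Set.mem_univ v) with h | h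
  · rw [Set.mem_singleton_iff.1 h]; exact Or.inl q.start_mem_support
  · exact Or.inl h

theorem opt_le_length {s : V} {t : G.toSimpleGraph.Walk s s} (ht : G.IsTour t) :
    G.opt s ≤ G.length t :=
  csInf_le ⟨0, by rintro _ ⟨p, -, rfl⟩; exact length_nonneg p⟩ ⟨t, ht, rfl⟩

end Steps

/-! ### The logarithmic upper bound -/

section Upper

variable {V : Type} {G : WeightedGraph V}

/-- The vertices of `A` lie at mutual distance at least `t`. -/
def Separated (G : WeightedGraph V) (t : ℝ) (A : Set V) : Prop :=
  A.Pairwise fun a b => ∀ w : G.toSimpleGraph.Walk a b, t ≤ G.length w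

theorem separated_insert {t : ℝ} {A : Set V} {a : V} (hA : G.Separated t A)
    (h : ∀ b ∈ A, a ≠ b → ∀ w : G.toSimpleGraph.Walk a b, t ≤ G.length w) :
    G.Separated t (insert a A) := by
  refine Set.pairwise_insert.2 ⟨hA, fun b hb hab => ⟨h b hb hab, fun w => ?_⟩⟩
  rw [← length_reverse]
  exact h b hb hab _

/-- A walk visiting a separated set `A` collects `t` for each of its vertices; `r` is the piece of
the walk travelled since the previous vertex `x` of the separated set. -/
theorem card_mul_le_of_separated [DecidableEq V] {t : ℝ} {u v : V}
    (p : G.toSimpleGraph.Walk u v) :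
    ∀ (x : V) (r : G.toSimpleGraph.Walk x u) (A : Finset V), (∀ a ∈ A, a ∈ p.support) → x ∉ A →
      G.Separated t (insert x (A : Set V)) → A.card * t ≤ G.length r + G.length p := by
  induction p with
  | @nil u =>
    intro x r A hA hx hsep
    have hA' : A ⊆ {u} := fun a ha => by simpa using hA a ha
    rcases Finset.subset_singleton_iff.1 hA' with rfl | rfl
    · simpa using length_nonneg r
    · have hxu : x ≠ u := by simpa using hx
      simpa using hsep (by simp) (by simp) hxu r
  | @cons u b v h p ih =>
    intro x r A hA hx hsep
    by_cases hu : u ∈ A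
    · have hsub : insert u ((A.erase u : Finset V) : Set V) ⊆ insert x (A : Set V) := by
        rw [← Finset.coe_insert, Finset.insert_erase hu]
        exact Set.subset_insert _ _
      have h1 := ih u (Walk.cons h Walk.nil) (A.erase u) (fun a ha => by
        have := hA a (Finset.mem_of_mem_erase ha)
        rw [Walk.support_cons, List.mem_cons] at this
        exact this.resolve_left (Finset.ne_of_mem_erase ha)) (by simp) (hsep.mono hsub)
      have hxu : x ≠ u := fun h => hx (h ▸ hu)
      have h2 := hsep (by simp) (by simp [hu]) hxu r
      have h3 : (A.card : ℝ) = (A.erase u).card + 1 := by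
        exact_mod_cast (Finset.card_erase_add_one hu).symm
      rw [length_cons, length_nil, add_zero] at h1
      rw [h3, length_cons]
      linarith
    · have h1 := ih x (r.append (Walk.cons h Walk.nil)) A (fun a ha => by
        have := hA a ha
        rw [Walk.support_cons, List.mem_cons] at this
        exact this.resolve_left (fun h => hu (h ▸ ha))) hx hsep
      rw [length_append, length_cons, length_nil] at h1
      rw [length_cons]
      linarith

theorem IsTour.card_mul_le [DecidableEq V] {t : ℝ} {s x : V} {p : G.toSimpleGraph.Walk s s}
    (hp : G.IsTour p) {A : Finset V} (hx : x ∉ A) (hA : G.Separated t (insert x (A : Set V))) :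
    A.card * t ≤ G.length p := by
  have h := card_mul_le_of_separated (p.rotate x (hp x)) x Walk.nil A
    (fun a _ => (Walk.mem_support_rotate_iff _ _ _).2 (hp a)) hx hA
  rw [length_nil, zero_add] at h
  refine h.trans_eq ?_
  rw [Walk.rotate, length_append, length_eq_add_of_mem_support p (hp x), add_comm]

/-- The steps of a Nearest Neighbor run, indexed by the vertices `A` in which they start, with
lengths `l`. If a step of length at least `t` starts in `a`, then all vertices visited later have
distance at least `t` from `a`; so the starts of the steps of length at least `t` and the final
vertex `x` are separated. -/
theorem NNRun.exists_steps [DecidableEq V] {S T : Set V} {v x : V}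
    {q : G.toSimpleGraph.Walk v x} (hq : G.NNRun S q T) (hv : v ∈ S) :
    ∃ (A : Finset V) (l : V → ℝ), G.length q = ∑ a ∈ A, l a ∧ x ∉ A ∧
      insert x (A : Set V) ⊆ insert v Sᶜ ∧
      ∀ (t : ℝ) (B : Finset V), B ⊆ A → (∀ b ∈ B, t ≤ l b) →
        G.Separated t (insert x (B : Set V)) := by
  induction hq with
  | done S v =>
    refine ⟨∅, fun _ => 0, by simp, by simp, by simp, fun t B hB _ => ?_⟩
    simp [Finset.subset_empty.1 hB, Separated]
  | @step S T v u x p q hs hq ih =>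
    obtain ⟨A, l, hlen, hxA, hsub, hsep⟩ := ih (Set.mem_insert u S)
    have hsub' : insert x (A : Set V) ⊆ Sᶜ := by
      refine hsub.trans (Set.insert_subset hs.1 (Set.compl_subset_compl.2 (Set.subset_insert u S)))
    have hvA : v ∉ A := fun h => hsub' (by simp [h]) hv
    have hvx : x ≠ v := fun h => hsub' (Set.mem_insert x A) (h ▸ hv)
    have hne : ∀ a ∈ A, a ≠ v := fun a ha h => hvA (h ▸ ha)
    refine ⟨insert v A, Function.update l v (G.length p), ?_, ?_, ?_, ?_⟩
    · rw [Finset.sum_insert hvA, length_append, hlen, Function.update_self]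
      congr 1
      exact Finset.sum_congr rfl fun a ha => (Function.update_of_ne (hne a ha) _ _).symm
    · simp [hxA, hvx]
    · rw [Finset.coe_insert, Set.insert_comm]
      exact Set.insert_subset_insert hsub'
    · intro t B hB hBl
      have hB' : B.erase v ⊆ A := fun b hb => by
        rw [Finset.mem_erase] at hb
        exact (Finset.mem_insert.1 (hB hb.2)).resolve_left hb.1
      have h1 := hsep t (B.erase v) hB' (fun b hb => by
        have := hBl b (Finset.mem_of_mem_erase hb)
        rwa [Function.update_of_ne (Finset.ne_of_mem_erase hb)] at this)
      by_cases hvB : v ∈ B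
      · rw [← Finset.insert_erase hvB, Finset.coe_insert, Set.insert_comm]
        refine separated_insert h1 fun b hb _ w => ?_
        have hbS : b ∉ S := hsub' (Set.insert_subset_insert (Finset.coe_subset.2 hB') hb)
        have h2 := hBl v hvB
        rw [Function.update_self] at h2
        exact h2.trans (hs.length_le hv hbS w)
      · rwa [Finset.erase_eq_of_notMem hvB] at h1

end Upper

end WeightedGraph

/-- If at most `L / t` of the values `f i` are at least `t`, for every `t`, then the `j`-th largest
value is at most `L / j`, and the values sum up to at most `L` times a harmonic number. -/
theorem Finset.sum_le_mul_harmonic {ι : Type} [DecidableEq ι] (s : Finset ι) (f : ι → ℝ) (L : ℝ)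
    (h : ∀ (t : ℝ) (B : Finset ι), B ⊆ s → (∀ i ∈ B, t ≤ f i) → B.card * t ≤ L) :
    ∑ i ∈ s, f i ≤ L * harmonic s.card := by
  induction s using Finset.induction_on_min_value f with
  | empty => simp
  | insert a s ha hmin ih =>
    have h1 := ih fun t B hB hBt => h t B (hB.trans (Finset.subset_insert a s)) hBt
    have h2 := h (f a) (insert a s) subset_rfl (fun i hi => by
      rcases Finset.mem_insert.1 hi with rfl | hi
      · exact le_rfl
      · exact hmin i hi)
    rw [Finset.sum_insert ha]
    rw [Finset.card_insert_of_notMem ha] at h2 ⊢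
    have h3 : f a ≤ L * ((s.card : ℝ) + 1)⁻¹ := by
      rw [← div_eq_mul_inv, le_div_iff₀ (by positivity), mul_comm]
      exact_mod_cast h2
    rw [harmonic_succ]
    push_cast
    linarith

namespace WeightedGraph

variable {V : Type} {G : WeightedGraph V}

/-- On every finite graph, Nearest Neighbor exceeds a given tour by a factor of at most
`2 + log n`: the steps contribute a harmonic number, the final return at most `1`. -/
theorem IsNNTour.length_le [Finite V] {s : V} {t p : G.toSimpleGraph.Walk s s}
    (ht : G.IsNNTour t) (hp : G.IsTour p) :
    G.length t ≤ (2 + Real.log (Nat.card V)) * G.length p := by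
  classical
  have := Fintype.ofFinite V
  obtain ⟨x, q, b, hq, hb, rfl⟩ := ht
  obtain ⟨A, l, hlen, hxA, -, hsep⟩ := hq.exists_steps (Set.mem_singleton s)
  have h1 := A.sum_le_mul_harmonic l (G.length p) fun t B hB hBl =>
    hp.card_mul_le (fun h => hxA (hB h)) (hsep t B hB hBl)
  have h2 : G.length b ≤ G.length p := by
    refine (hb (p.dropUntil x (hp x))).trans ?_
    rw [length_eq_add_of_mem_support p (hp x)]
    linarith [length_nonneg (p.takeUntil x (hp x))]
  have hc : A.card ≤ Nat.card V := by
    rw [Nat.card_eq_fintype_card]; exact Finset.card_le_univ A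
  have h3 : (harmonic A.card : ℝ) ≤ 1 + Real.log (Nat.card V) := by
    refine (harmonic_le_one_add_log _).trans ?_
    rcases Nat.eq_zero_or_pos A.card with h0 | h0
    · simp [h0, Real.log_natCast_nonneg]
    · have : (A.card : ℝ) ≤ Nat.card V := by exact_mod_cast hc
      linarith [Real.log_le_log (by exact_mod_cast h0) this]
  have h4 := mul_le_mul_of_nonneg_left h3 (length_nonneg p)
  rw [length_append, hlen]
  linarith

theorem IsNNTour.length_le_mul_opt [Finite V] {s : V} {t : G.toSimpleGraph.Walk s s}
    (ht : G.IsNNTour t) : G.length t ≤ (2 + Real.log (Nat.card V)) * G.opt s := by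
  have hpos : 0 < 2 + Real.log (Nat.card V) := by
    linarith [Real.log_natCast_nonneg (Nat.card V)]
  rw [← div_le_iff₀' hpos]
  refine le_csInf ⟨_, t, ht.isTour, rfl⟩ ?_
  rintro _ ⟨p, hp, rfl⟩
  rw [div_le_iff₀' hpos]
  exact ht.length_le hp

end WeightedGraph

theorem nnCompetitiveRatioOnTrees_le {n : ℕ} (hn : 2 ≤ n) :
    nnCompetitiveRatioOnTrees n ≤ ENNReal.ofReal (4 * Real.log n) := by
  refine sInf_le fun V _ G hV _ s t ht => ?_
  have hlog : Real.log 2 ≤ Real.log n := Real.log_le_log (by norm_num) (by exact_mod_cast hn)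
  have h2 := Real.log_two_gt_d9
  rw [← ENNReal.ofReal_mul (by linarith)]
  refine ENNReal.ofReal_le_ofReal (ht.length_le_mul_opt.trans ?_)
  rw [hV]
  refine mul_le_mul_of_nonneg_right (by linarith) (Real.sInf_nonneg ?_)
  rintro _ ⟨p, -, rfl⟩
  exact WeightedGraph.length_nonneg p

namespace SpikedVertex

/-! ### The metric of the trees `G_k` -/

/-- The distance between two vertices of `G_k`. -/
noncomputable def dist : {k : ℕ} → SpikedVertex k → SpikedVertex k → ℝ
  | _, base, base => 0
  | _, left u, left v => dist u v
  | _, right u, right v => dist u v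
  | k + 1, left u, right v => dist u (r k) + ((k : ℝ) + 1) + dist (l k) v
  | k + 1, right v, left u => dist u (r k) + ((k : ℝ) + 1) + dist (l k) v
  | k + 1, left u, mid => dist u (r k) + ((k : ℝ) + 1) + 1
  | k + 1, mid, left u => dist u (r k) + ((k : ℝ) + 1) + 1
  | k + 1, right v, mid => dist (l k) v + 1
  | k + 1, mid, right v => dist (l k) v + 1
  | _, mid, mid => 0

theorem dist_comm {k : ℕ} (u v : SpikedVertex k) : dist u v = dist v u := by
  induction k with
  | zero => cases u; cases v; rfl
  | succ k ih => cases u <;> cases v <;> simp only [dist] <;> exact ih _ _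

theorem dist_self {k : ℕ} (u : SpikedVertex k) : dist u u = 0 := by
  induction k with
  | zero => cases u; simp [dist]
  | succ k ih => cases u <;> simp [dist, ih]

theorem dist_nonneg {k : ℕ} (u v : SpikedVertex k) : 0 ≤ dist u v := by
  induction k with
  | zero => cases u; cases v; simp [dist]
  | succ k ih =>
    have hk : (0 : ℝ) ≤ k := Nat.cast_nonneg k
    cases u <;> cases v <;> simp only [dist] <;>
      first
      | exact ih _ _
      | exact le_rfl
      | (rename_i a b; linarith [ih a (r k), ih b (r k), ih (l k) a, ih (l k) b])
      | (rename_i a; linarith [ih a (r k), ih (l k) a])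

theorem dist_le_edgeLength_add {k : ℕ} {u v : SpikedVertex k} (h : 0 < edgeLength u v)
    (w : SpikedVertex k) : dist u w ≤ edgeLength u v + dist v w := by
  induction k with
  | zero => cases u; cases v; simp [edgeLength] at h
  | succ k ih =>
    have hk : (0 : ℝ) ≤ k := Nat.cast_nonneg k
    cases u <;> cases v <;> simp only [edgeLength] at h ⊢
    case left.left u v =>
      cases w <;> simp only [dist]
      · exact ih h _
      · linarith [ih h (r k)]
      · linarith [ih h (r k)]
    case right.right u v =>
      have := ih h (l k)
      rw [dist_comm u, dist_comm v] at this
      cases w <;> simp only [dist]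
      · linarith
      · exact ih h _
      · linarith
    case left.right u v =>
      split_ifs at h ⊢ with huv
      · obtain ⟨rfl, rfl⟩ := huv
        cases w <;> simp only [dist, dist_self]
        · rename_i w; linarith [dist_comm w (r k)]
        · linarith
        · linarith
      · exact absurd h (lt_irrefl 0)
    case right.left u v =>
      split_ifs at h ⊢ with huv
      · obtain ⟨rfl, rfl⟩ := huv
        cases w <;> simp only [dist, dist_self]
        · rename_i w; linarith [dist_comm w (r k)]
        · linarith
        · linarith
      · exact absurd h (lt_irrefl 0)
    case right.mid u =>
      split_ifs at h ⊢ with hu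
      · subst hu
        cases w <;> simp only [dist, dist_self] <;> linarith
      · exact absurd h (lt_irrefl 0)
    case mid.right u =>
      split_ifs at h ⊢ with hu
      · subst hu
        cases w <;> simp only [dist, dist_self] <;> linarith
      · exact absurd h (lt_irrefl 0)
    all_goals exact absurd h (lt_irrefl 0)

theorem dist_le_length {k : ℕ} {u v : SpikedVertex k} (p : (spikedPath k).toSimpleGraph.Walk u v) :
    dist u v ≤ (spikedPath k).length p := by
  induction p with
  | nil => simp [dist_self]
  | cons h p ih =>
    rw [WeightedGraph.length_cons]
    exact (dist_le_edgeLength_add h _).trans (add_le_add_right ih _)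

/-- The inclusion of the first copy of `G_k` in `G_(k+1)`. -/
noncomputable def leftHom (k : ℕ) :
    (spikedPath k).toSimpleGraph →g (spikedPath (k + 1)).toSimpleGraph where
  toFun := left
  map_rel' h := h

/-- The inclusion of the second copy of `G_k` in `G_(k+1)`. -/
noncomputable def rightHom (k : ℕ) :
    (spikedPath k).toSimpleGraph →g (spikedPath (k + 1)).toSimpleGraph where
  toFun := right
  map_rel' h := h

/-- The copy of a walk of `G_k` in the first half of `G_(k+1)`. -/
noncomputable def leftWalk {k : ℕ} {u v : SpikedVertex k}
    (p : (spikedPath k).toSimpleGraph.Walk u v) :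
    (spikedPath (k + 1)).toSimpleGraph.Walk (left u) (left v) :=
  p.map (leftHom k)

/-- The copy of a walk of `G_k` in the second half of `G_(k+1)`. -/
noncomputable def rightWalk {k : ℕ} {u v : SpikedVertex k}
    (p : (spikedPath k).toSimpleGraph.Walk u v) :
    (spikedPath (k + 1)).toSimpleGraph.Walk (right u) (right v) :=
  p.map (rightHom k)

@[simp] theorem length_leftWalk {k : ℕ} {u v : SpikedVertex k}
    (p : (spikedPath k).toSimpleGraph.Walk u v) :
    (spikedPath (k + 1)).length (leftWalk p) = (spikedPath k).length p :=
  WeightedGraph.length_map _ (fun _ _ _ => rfl) p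

@[simp] theorem length_rightWalk {k : ℕ} {u v : SpikedVertex k}
    (p : (spikedPath k).toSimpleGraph.Walk u v) :
    (spikedPath (k + 1)).length (rightWalk p) = (spikedPath k).length p :=
  WeightedGraph.length_map _ (fun _ _ _ => rfl) p

theorem left_mem_support_leftWalk {k : ℕ} {u v w : SpikedVertex k}
    {p : (spikedPath k).toSimpleGraph.Walk u v} (hw : w ∈ p.support) :
    left w ∈ (leftWalk p).support := by
  have h := List.mem_map_of_mem (f := leftHom k) hw
  rw [← Walk.support_map] at h
  exact h

theorem right_mem_support_rightWalk {k : ℕ} {u v w : SpikedVertex k}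
    {p : (spikedPath k).toSimpleGraph.Walk u v} (hw : w ∈ p.support) :
    right w ∈ (rightWalk p).support := by
  have h := List.mem_map_of_mem (f := rightHom k) hw
  rw [← Walk.support_map] at h
  exact h

theorem weight_left_right (k : ℕ) :
    (spikedPath (k + 1)).weight (left (r k)) (right (l k)) = k + 1 := by
  simp [spikedPath, edgeLength]

theorem weight_right_left (k : ℕ) :
    (spikedPath (k + 1)).weight (right (l k)) (left (r k)) = k + 1 := by
  simp [spikedPath, edgeLength]

theorem weight_right_mid (k : ℕ) : (spikedPath (k + 1)).weight (right (l k)) mid = 1 := by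
  simp [spikedPath, edgeLength]

theorem weight_mid_right (k : ℕ) : (spikedPath (k + 1)).weight mid (right (l k)) = 1 := by
  simp [spikedPath, edgeLength]

theorem adj_left_right (k : ℕ) : (spikedPath (k + 1)).Adj (left (r k)) (right (l k)) := by
  change 0 < edgeLength _ _
  simp only [edgeLength, and_self, if_true]
  positivity

theorem adj_right_mid (k : ℕ) : (spikedPath (k + 1)).Adj (right (l k)) mid := by
  change 0 < edgeLength _ _
  simp [edgeLength]

theorem exists_length_eq_dist {k : ℕ} (u v : SpikedVertex k) :
    ∃ p : (spikedPath k).toSimpleGraph.Walk u v, (spikedPath k).length p = dist u v := by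
  have hsymm : ∀ {k : ℕ} {u v : SpikedVertex k},
      (∃ p : (spikedPath k).toSimpleGraph.Walk u v, (spikedPath k).length p = dist u v) →
      ∃ p : (spikedPath k).toSimpleGraph.Walk v u, (spikedPath k).length p = dist v u := by
    rintro k u v ⟨p, hp⟩
    exact ⟨p.reverse, by rw [WeightedGraph.length_reverse, hp, dist_comm]⟩
  induction k with
  | zero => cases u; cases v; exact ⟨Walk.nil, by simp [dist]⟩
  | succ k ih =>
    have hLR : ∀ a b : SpikedVertex k,
        ∃ p : (spikedPath (k + 1)).toSimpleGraph.Walk (left a) (right b),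
          (spikedPath (k + 1)).length p = dist (left a) (right b) := fun a b => by
      obtain ⟨p, hp⟩ := ih a (r k)
      obtain ⟨q, hq⟩ := ih (l k) b
      refine ⟨(leftWalk p).append (Walk.cons (adj_left_right k) (rightWalk q)), ?_⟩
      rw [WeightedGraph.length_append, WeightedGraph.length_cons, length_leftWalk,
        length_rightWalk, hp, hq, weight_left_right]
      simp only [dist]
      ring
    have hRM : ∀ b : SpikedVertex k,
        ∃ p : (spikedPath (k + 1)).toSimpleGraph.Walk (right b) mid,
          (spikedPath (k + 1)).length p = dist (right b) mid := fun b => by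
      obtain ⟨q, hq⟩ := ih b (l k)
      refine ⟨(rightWalk q).append (Walk.cons (adj_right_mid k) Walk.nil), ?_⟩
      simp [dist, dist_comm b, hq, weight_right_mid]
    have hLM : ∀ a : SpikedVertex k,
        ∃ p : (spikedPath (k + 1)).toSimpleGraph.Walk (left a) mid,
          (spikedPath (k + 1)).length p = dist (left a) mid := fun a => by
      obtain ⟨p, hp⟩ := hLR a (l k)
      obtain ⟨q, hq⟩ := hRM (l k)
      refine ⟨p.append q, ?_⟩
      rw [WeightedGraph.length_append, hp, hq]
      simp [dist, dist_self]
    cases u <;> cases v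
    case left.left a b =>
      obtain ⟨p, hp⟩ := ih a b
      exact ⟨leftWalk p, (length_leftWalk p).trans hp⟩
    case right.right a b =>
      obtain ⟨p, hp⟩ := ih a b
      exact ⟨rightWalk p, (length_rightWalk p).trans hp⟩
    case mid.mid => exact ⟨Walk.nil, by simp [dist]⟩
    case left.right a b => exact hLR a b
    case right.left a b => exact hsymm (hLR b a)
    case right.mid a => exact hRM a
    case mid.right a => exact hsymm (hRM a)
    case left.mid a => exact hLM a
    case mid.left a => exact hsymm (hLM a)

theorem dist_l_r (k : ℕ) : dist (l k) (r k) = 2 ^ (k + 1) - (k : ℝ) - 2 := by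
  induction k with
  | zero => norm_num [l, r, dist]
  | succ k ih => simp only [l, r, dist, ih]; push_cast; ring

/-! ### Vertex count and tree property -/

/-- The vertices of `G_(k+1)` are those of two copies of `G_k` and one more. -/
def succEquiv (k : ℕ) : SpikedVertex (k + 1) ≃ Option (SpikedVertex k ⊕ SpikedVertex k) where
  toFun
    | left v => some (Sum.inl v)
    | right v => some (Sum.inr v)
    | mid => none
  invFun
    | some (Sum.inl v) => left v
    | some (Sum.inr v) => right v
    | none => mid
  left_inv v := by cases v <;> rfl
  right_inv v := by rcases v with _ | v | v <;> rfl

instance instFinite (k : ℕ) : Finite (SpikedVertex k) := by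
  induction k with
  | zero => exact Finite.of_injective (fun _ => ()) (by rintro ⟨⟩ ⟨⟩ _; rfl)
  | succ k ih => exact Finite.of_equiv _ (succEquiv k).symm

theorem card_add_one (k : ℕ) : Nat.card (SpikedVertex k) + 1 = 2 ^ (k + 1) := by
  induction k with
  | zero =>
    have : Unique (SpikedVertex 0) := ⟨⟨base⟩, by rintro ⟨⟩; rfl⟩
    simp
  | succ k ih =>
    rw [Nat.card_congr (succEquiv k), Finite.card_option, Nat.card_sum, pow_succ, ← ih]
    ring

end SpikedVertex

/-- Every edge of `G` is the only edge across some cut `f`. This criterion for acyclicity passes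
easily to larger graphs glued from smaller ones. -/
def WeightedGraph.HasCuts {V : Type} (G : WeightedGraph V) : Prop :=
  ∀ u v, G.Adj u v → ∃ f : V → Prop, ¬(f u ↔ f v) ∧
    ∀ a b, G.Adj a b → ¬(f a ↔ f b) → s(a, b) = s(u, v)

theorem WeightedGraph.HasCuts.isAcyclic {V : Type} {G : WeightedGraph V} (h : G.HasCuts) :
    G.toSimpleGraph.IsAcyclic := by
  rw [isAcyclic_iff_forall_adj_isBridge]
  intro u v huv
  rw [isBridge_iff]
  obtain ⟨f, hf, hcut⟩ := h u v huv
  rintro ⟨p⟩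
  refine hf ?_
  clear hf huv
  have key : ∀ {x y : V} (p : (G.toSimpleGraph.deleteEdges {s(u, v)}).Walk x y),
      f x ↔ f y := by
    intro x y p
    induction p with
    | nil => rfl
    | cons hab p ih =>
      rw [← ih]
      rw [deleteEdges_adj] at hab
      by_contra hne
      exact hab.2 (hcut _ _ hab.1 hne)
  exact key p

namespace SpikedVertex

theorem eq_of_adj_succ {k : ℕ} {x y : SpikedVertex (k + 1)} (h : (spikedPath (k + 1)).Adj x y) :
    (∃ a b, (spikedPath k).Adj a b ∧ x = left a ∧ y = left b) ∨
    (∃ a b, (spikedPath k).Adj a b ∧ x = right a ∧ y = right b) ∨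
    s(x, y) = s(left (r k), right (l k)) ∨ s(x, y) = s(right (l k), mid) := by
  change 0 < edgeLength x y at h
  cases x <;> cases y <;> simp only [edgeLength] at h
  case left.left a b => exact Or.inl ⟨a, b, h, rfl, rfl⟩
  case right.right a b => exact Or.inr (Or.inl ⟨a, b, h, rfl, rfl⟩)
  all_goals first
    | exact absurd h (lt_irrefl 0)
    | (split_ifs at h with hc
       · simp [hc]
       · exact absurd h (lt_irrefl 0))

/-- A cut of a copy of `G_k` extends to `G_(k+1)`: the rest of `G_(k+1)` goes to the side of the
vertex by which it is attached. -/
theorem hasCuts (k : ℕ) : (spikedPath k).HasCuts := by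
  induction k with
  | zero =>
    rintro ⟨⟩ ⟨⟩ h
    exact absurd rfl h.ne
  | succ k ih =>
    intro u v huv
    rcases eq_of_adj_succ huv with ⟨a, b, hab, rfl, rfl⟩ | ⟨a, b, hab, rfl, rfl⟩ | huv | huv
    · obtain ⟨g, hg, hcut⟩ := ih a b hab
      refine ⟨fun | left c => g c | right _ => g (r k) | mid => g (r k), hg, fun x y hxy hne => ?_⟩
      rcases eq_of_adj_succ hxy with ⟨c, d, hcd, rfl, rfl⟩ | ⟨c, d, hcd, rfl, rfl⟩ | hxy | hxy
      · simpa using hcut c d hcd hne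
      · exact absurd Iff.rfl hne
      · rcases Sym2.eq_iff.1 hxy with ⟨rfl, rfl⟩ | ⟨rfl, rfl⟩ <;> exact absurd Iff.rfl hne
      · rcases Sym2.eq_iff.1 hxy with ⟨rfl, rfl⟩ | ⟨rfl, rfl⟩ <;> exact absurd Iff.rfl hne
    · obtain ⟨g, hg, hcut⟩ := ih a b hab
      refine ⟨fun | left _ => g (l k) | right c => g c | mid => g (l k), hg, fun x y hxy hne => ?_⟩
      rcases eq_of_adj_succ hxy with ⟨c, d, hcd, rfl, rfl⟩ | ⟨c, d, hcd, rfl, rfl⟩ | hxy | hxy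
      · exact absurd Iff.rfl hne
      · simpa using hcut c d hcd hne
      · rcases Sym2.eq_iff.1 hxy with ⟨rfl, rfl⟩ | ⟨rfl, rfl⟩ <;> exact absurd Iff.rfl hne
      · rcases Sym2.eq_iff.1 hxy with ⟨rfl, rfl⟩ | ⟨rfl, rfl⟩ <;> exact absurd Iff.rfl hne
    · refine ⟨fun | left _ => True | right _ => False | mid => False, ?_, fun x y hxy hne => ?_⟩
      · rcases Sym2.eq_iff.1 huv with ⟨rfl, rfl⟩ | ⟨rfl, rfl⟩ <;> simp
      rw [huv]
      rcases eq_of_adj_succ hxy with ⟨c, d, hcd, rfl, rfl⟩ | ⟨c, d, hcd, rfl, rfl⟩ | hxy | hxy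
      · exact absurd Iff.rfl hne
      · exact absurd Iff.rfl hne
      · exact hxy
      · rcases Sym2.eq_iff.1 hxy with ⟨rfl, rfl⟩ | ⟨rfl, rfl⟩ <;> exact absurd Iff.rfl hne
    · refine ⟨fun | left _ => False | right _ => False | mid => True, ?_, fun x y hxy hne => ?_⟩
      · rcases Sym2.eq_iff.1 huv with ⟨rfl, rfl⟩ | ⟨rfl, rfl⟩ <;> simp
      rw [huv]
      rcases eq_of_adj_succ hxy with ⟨c, d, hcd, rfl, rfl⟩ | ⟨c, d, hcd, rfl, rfl⟩ | hxy | hxy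
      · exact absurd Iff.rfl hne
      · exact absurd Iff.rfl hne
      · rcases Sym2.eq_iff.1 hxy with ⟨rfl, rfl⟩ | ⟨rfl, rfl⟩ <;> exact absurd Iff.rfl hne
      · exact hxy

theorem connected (k : ℕ) : (spikedPath k).toSimpleGraph.Connected where
  preconnected u v := ⟨(exists_length_eq_dist u v).choose⟩
  nonempty := ⟨l k⟩

theorem isTree (k : ℕ) : (spikedPath k).toSimpleGraph.IsTree :=
  ⟨connected k, (hasCuts k).isAcyclic⟩

end SpikedVertex

/-! ### Optimal tours of the trees `G_k` -/

theorem SimpleGraph.Walk.abs_sub_le_sum_darts {W : Type} {H : SimpleGraph W} (f : W → ℝ) {u v : W}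
    (p : H.Walk u v) : |f u - f v| ≤ (p.darts.map fun d => |f d.fst - f d.snd|).sum := by
  induction p with
  | nil => simp
  | cons h p ih =>
    rw [Walk.darts_cons, List.map_cons, List.sum_cons]
    exact (abs_sub_le _ _ _).trans (add_le_add_right ih _)

theorem SimpleGraph.Walk.two_mul_abs_sub_le_sum_darts {W : Type} {H : SimpleGraph W} (f : W → ℝ)
    {s u v : W} (p : H.Walk s s) (hu : u ∈ p.support) (hv : v ∈ p.support) :
    2 * |f u - f v| ≤ (p.darts.map fun d => |f d.fst - f d.snd|).sum := by
  classical
  rw [← ((p.rotate_darts u hu).perm.map _).sum_eq]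
  have hv' : v ∈ (p.rotate u hu).support := (p.mem_support_rotate_iff u hu).2 hv
  rw [← (p.rotate u hu).take_spec hv', Walk.darts_append, List.map_append, List.sum_append]
  have h1 := ((p.rotate u hu).takeUntil v hv').abs_sub_le_sum_darts f
  have h2 := ((p.rotate u hu).dropUntil v hv').abs_sub_le_sum_darts f
  rw [abs_sub_comm] at h2
  linarith

namespace SpikedVertex

/-- The retraction of `G_(k+1)` to its first copy of `G_k`. -/
def toLeft {k : ℕ} : SpikedVertex (k + 1) → SpikedVertex k
  | left v => v
  | right _ => r k
  | mid => r k

/-- The retraction of `G_(k+1)` to its second copy of `G_k`. -/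
def toRight {k : ℕ} : SpikedVertex (k + 1) → SpikedVertex k
  | left _ => l k
  | right v => v
  | mid => l k

/-- The indicator function of the first copy of `G_k` in `G_(k+1)`. -/
def leftIndicator {k : ℕ} : SpikedVertex (k + 1) → ℝ
  | left _ => 1
  | right _ => 0
  | mid => 0

/-- The indicator function of the vertex `mid` of `G_(k+1)`. -/
def midIndicator {k : ℕ} : SpikedVertex (k + 1) → ℝ
  | left _ => 0
  | right _ => 0
  | mid => 1

theorem edgeLength_succ_le {k : ℕ} {x y : SpikedVertex (k + 1)} (h : x = y ∨ 0 < edgeLength x y) :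
    edgeLength (toLeft x) (toLeft y) + edgeLength (toRight x) (toRight y) +
      (((k : ℝ) + 1) * |leftIndicator x - leftIndicator y| + |midIndicator x - midIndicator y|) ≤
      edgeLength x y := by
  rcases h with rfl | h
  · simp [edgeLength_self]
  rcases eq_of_adj_succ h with ⟨a, b, -, rfl, rfl⟩ | ⟨a, b, -, rfl, rfl⟩ | hxy | hxy
  · simp [toLeft, toRight, leftIndicator, midIndicator, edgeLength, edgeLength_self]
  · simp [toLeft, toRight, leftIndicator, midIndicator, edgeLength, edgeLength_self]
  · rcases Sym2.eq_iff.1 hxy with ⟨rfl, rfl⟩ | ⟨rfl, rfl⟩ <;>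
      simp [toLeft, toRight, leftIndicator, midIndicator, edgeLength, edgeLength_self]
  · rcases Sym2.eq_iff.1 hxy with ⟨rfl, rfl⟩ | ⟨rfl, rfl⟩ <;>
      simp [toLeft, toRight, leftIndicator, midIndicator, edgeLength, edgeLength_self]

theorem eq_or_edgeLength_pos_of_succ {k : ℕ} {x y : SpikedVertex (k + 1)}
    (h : x = y ∨ 0 < edgeLength x y) :
    (toLeft x = toLeft y ∨ 0 < edgeLength (toLeft x) (toLeft y)) ∧
      (toRight x = toRight y ∨ 0 < edgeLength (toRight x) (toRight y)) := by
  rcases h with rfl | h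
  · exact ⟨Or.inl rfl, Or.inl rfl⟩
  rcases eq_of_adj_succ h with ⟨a, b, hab, rfl, rfl⟩ | ⟨a, b, hab, rfl, rfl⟩ | hxy | hxy
  · exact ⟨Or.inr hab, Or.inl rfl⟩
  · exact ⟨Or.inl rfl, Or.inr hab⟩
  · rcases Sym2.eq_iff.1 hxy with ⟨rfl, rfl⟩ | ⟨rfl, rfl⟩ <;> exact ⟨Or.inl rfl, Or.inl rfl⟩
  · rcases Sym2.eq_iff.1 hxy with ⟨rfl, rfl⟩ | ⟨rfl, rfl⟩ <;> exact ⟨Or.inl rfl, Or.inl rfl⟩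

/-- The lower bound for tours of `G_k`, stated for the image under `f` of a closed walk in any graph
that may also rest, so that it can be applied to the two retractions of a tour of `G_(k+1)`. -/
theorem le_sum_edgeLength {W : Type} {H : SimpleGraph W} {s : W} (p : H.Walk s s) {k : ℕ}
    (f : W → SpikedVertex k)
    (hf : ∀ a b, H.Adj a b → f a = f b ∨ 0 < edgeLength (f a) (f b))
    (hp : ∀ v, ∃ w ∈ p.support, f w = v) :
    6 * 2 ^ k - 2 * (k : ℝ) - 6 ≤ (p.darts.map fun d => edgeLength (f d.fst) (f d.snd)).sum := by
  induction k with
  | zero =>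
    refine le_trans (by norm_num) (List.sum_nonneg fun x hx => ?_)
    obtain ⟨d, -, rfl⟩ := List.mem_map.1 hx
    rcases hf _ _ d.adj with h | h
    · rw [h, edgeLength_self]
    · exact h.le
  | succ k ih =>
    have h1 := ih (toLeft ∘ f) (fun a b h => (eq_or_edgeLength_pos_of_succ (hf a b h)).1)
      fun v => by
        obtain ⟨w, hw, hwv⟩ := hp (left v)
        exact ⟨w, hw, by simp [hwv, toLeft]⟩
    have h2 := ih (toRight ∘ f) (fun a b h => (eq_or_edgeLength_pos_of_succ (hf a b h)).2)
      fun v => by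
        obtain ⟨w, hw, hwv⟩ := hp (right v)
        exact ⟨w, hw, by simp [hwv, toRight]⟩
    obtain ⟨a, ha, hal⟩ := hp (left (l k))
    obtain ⟨b, hb, hbm⟩ := hp mid
    have h3 := p.two_mul_abs_sub_le_sum_darts (leftIndicator ∘ f) ha hb
    have h4 := p.two_mul_abs_sub_le_sum_darts (midIndicator ∘ f) ha hb
    have h5 := List.sum_le_sum fun (d : H.Dart) (_ : d ∈ p.darts) =>
      edgeLength_succ_le (hf _ _ d.adj)
    simp only [List.sum_map_add, List.sum_map_mul_left] at h5
    simp only [Function.comp_apply, hal, hbm] at h1 h2 h3 h4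
    have e1 : |leftIndicator (left (l k)) - leftIndicator (mid (k := k))| = 1 := by
      simp [leftIndicator]
    have e2 : |midIndicator (left (l k)) - midIndicator (mid (k := k))| = 1 := by
      simp [midIndicator]
    rw [e1] at h3
    rw [e2] at h4
    have h6 := mul_le_mul_of_nonneg_left h3 (show (0 : ℝ) ≤ k + 1 by positivity)
    push_cast
    rw [pow_succ]
    linarith

theorem exists_isTour (k : ℕ) : ∃ t : (spikedPath k).toSimpleGraph.Walk (l k) (l k),
    (spikedPath k).IsTour t ∧ (spikedPath k).length t = 6 * 2 ^ k - 2 * (k : ℝ) - 6 := by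
  classical
  induction k with
  | zero =>
    refine ⟨Walk.nil, ?_, by norm_num⟩
    rintro ⟨⟩
    simp [l]
  | succ k ih =>
    obtain ⟨t, ht, hlen⟩ := ih
    -- The tour of the first copy is interrupted at `r_k` by a trip to `mid` and the second copy.
    have hr := ht (r k)
    change ∃ t : (spikedPath (k + 1)).toSimpleGraph.Walk (left (l k)) (left (l k)),
      (spikedPath (k + 1)).IsTour t ∧
      (spikedPath (k + 1)).length t = 6 * 2 ^ (k + 1) - 2 * ((k + 1 : ℕ) : ℝ) - 6
    refine ⟨(leftWalk (t.takeUntil _ hr)).append (Walk.cons (adj_left_right k)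
      ((rightWalk t).append (Walk.cons (adj_right_mid k) (Walk.cons (adj_right_mid k).symm
        (Walk.cons (adj_left_right k).symm (leftWalk (t.dropUntil _ hr))))))), ?_, ?_⟩
    · intro v
      cases v with
      | left v =>
        have hv := ht v
        rw [← t.take_spec hr, Walk.mem_support_append_iff] at hv
        rcases hv with hv | hv
        · simp [Walk.mem_support_append_iff, left_mem_support_leftWalk hv]
        · simp [Walk.mem_support_append_iff, left_mem_support_leftWalk hv]
      | right v => simp [Walk.mem_support_append_iff, right_mem_support_rightWalk (ht v)]
      | mid => simp [Walk.mem_support_append_iff]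
    · have h := WeightedGraph.length_eq_add_of_mem_support t hr
      simp only [WeightedGraph.length_append, WeightedGraph.length_cons, length_leftWalk,
        length_rightWalk, weight_left_right, weight_right_left, weight_right_mid, weight_mid_right]
      push_cast
      rw [pow_succ]
      linarith

theorem opt_spikedPath (k : ℕ) :
    (spikedPath k).opt (l k) = 6 * 2 ^ k - 2 * (k : ℝ) - 6 := by
  refine IsLeast.csInf_eq ⟨?_, ?_⟩
  · obtain ⟨t, ht, hlen⟩ := exists_isTour k
    exact ⟨t, ht, hlen⟩
  · rintro _ ⟨p, hp, rfl⟩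
    exact le_sum_edgeLength p id (fun a b h => Or.inr h) fun v => ⟨v, hp v, rfl⟩

/-! ### Nearest Neighbor on the trees `G_k` -/

/-- The vertex of `G_k` that the bad Nearest Neighbor run from `l_k` visits last. -/
def last : (k : ℕ) → SpikedVertex k
  | 0 => base
  | _ + 1 => mid

/-- The length of the bad Nearest Neighbor run on `G_k`, from `l_k` to its last vertex. -/
noncomputable def runLength : ℕ → ℝ
  | 0 => 0
  | k + 1 => runLength k + (dist (last k) (r k) + (k + 1)) +
      (runLength k + (dist (l k) (last k) + 1))

/-- The balance behind the choice of the edge lengths: from the last vertex of the first copy of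
`G_k`, a neighbor of `l_k` at distance `1` and the second copy are equally far away. -/
theorem dist_last_r_add (k : ℕ) : dist (last k) (r k) + k = dist (l k) (last k) := by
  cases k with
  | zero => simp [last, l, r, dist]
  | succ k => simp only [last, l, r, dist]; push_cast; ring

theorem dist_l_last_succ (k : ℕ) : dist (l (k + 1)) (last (k + 1)) = 2 ^ (k + 1) := by
  simp only [last, l, dist, dist_l_r]
  ring

theorem runLength_succ (k : ℕ) : runLength (k + 1) = ((k : ℝ) + 2) * 2 ^ (k + 1) - 2 := by
  induction k with
  | zero => norm_num [runLength, last, l, r, dist]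
  | succ k ih =>
    have h1 := dist_last_r_add (k + 1)
    have h2 := dist_l_last_succ k
    rw [runLength, ih]
    push_cast at h1 ⊢
    rw [pow_succ _ (k + 1)]
    linarith

end SpikedVertex

theorem WeightedGraph.exists_nnRun_insert {V : Type} {G : WeightedGraph V} {δ : V → V → ℝ}
    (hδ : ∀ u v, ∃ p : G.toSimpleGraph.Walk u v, G.length p = δ u v)
    (hδ' : ∀ (u v) (p : G.toSimpleGraph.Walk u v), δ u v ≤ G.length p) {S : Set V} {v u : V}
    (hu : u ∉ S) (h : ∀ u', u' ∉ S → δ v u ≤ δ v u') :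
    ∃ p : G.toSimpleGraph.Walk v u, G.NNRun S p (insert u S) ∧ G.length p = δ v u := by
  obtain ⟨p, hp⟩ := hδ v u
  refine ⟨p, ?_, hp⟩
  have := NNRun.step p Walk.nil (isNearestStep_of_forall_length_le p hu fun u' hu' q =>
    hp.trans_le ((h u' hu').trans (hδ' _ _ q))) (NNRun.done _ u)
  rwa [Walk.append_nil] at this

namespace SpikedVertex

/-- The bad Nearest Neighbor run on a copy `φ` of `G_k` inside a larger graph with metric `δ`. It is
not lured out of the copy if the unvisited vertices outside of it are reached only through `l_k`,
at distance at least `1` from there, or through `r_k`, at distance at least `k + 1` from there. -/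
theorem exists_nnRun {V : Type} {G : WeightedGraph V} {δ : V → V → ℝ}
    (hδ : ∀ u v, ∃ p : G.toSimpleGraph.Walk u v, G.length p = δ u v)
    (hδ' : ∀ (u v) (p : G.toSimpleGraph.Walk u v), δ u v ≤ G.length p) {k : ℕ} :
    ∀ (φ : SpikedVertex k → V) (S : Set V), Function.Injective φ →
      (∀ a b, δ (φ a) (φ b) = dist a b) → (∀ a, φ a ∈ S ↔ a = l k) →
      (∀ a u, u ∉ S → u ∉ Set.range φ →
        min (dist a (l k) + 1) (dist a (r k) + (k + 1)) ≤ δ (φ a) u) →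
      ∃ q : G.toSimpleGraph.Walk (φ (l k)) (φ (last k)),
        G.NNRun S q (S ∪ Set.range φ) ∧ G.length q = runLength k := by
  induction k with
  | zero =>
    intro φ S _ _ hS _
    refine ⟨(Walk.nil : G.toSimpleGraph.Walk (φ base) (φ base)), ?_,
      WeightedGraph.length_nil⟩
    have : S ∪ Set.range φ = S := by
      refine Set.union_eq_left.2 ?_
      rintro _ ⟨⟨⟩, rfl⟩
      exact (hS base).2 rfl
    rw [this]
    exact WeightedGraph.NNRun.done _ _
  | succ k ih =>
    intro φ S hinj hdist hS hout
    have hk : (0 : ℝ) ≤ k := Nat.cast_nonneg k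
    have hbal := dist_last_r_add k
    push_cast at hout
    change ∃ q : G.toSimpleGraph.Walk (φ (left (l k))) (φ mid),
      G.NNRun S q (S ∪ Set.range φ) ∧ G.length q = runLength (k + 1)
    obtain ⟨q₁, hrun₁, hlen₁⟩ : ∃ q : G.toSimpleGraph.Walk (φ (left (l k))) (φ (left (last k))),
        G.NNRun S q (S ∪ Set.range (φ ∘ left)) ∧ G.length q = runLength k :=
      ih (φ ∘ left) S (hinj.comp fun _ _ h => by injection h)
      (fun a b => hdist _ _)
      (fun a => (hS (left a)).trans ⟨fun h => by injection h, fun h => by rw [h]; rfl⟩) (by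
        intro a u hu hur
        by_cases h : u ∈ Set.range φ
        · obtain ⟨x, rfl⟩ := h
          cases x with
          | left b => exact absurd ⟨b, rfl⟩ hur
          | right b =>
            refine (min_le_right _ _).trans ?_
            simp only [Function.comp, hdist, dist]
            linarith [dist_nonneg (l k) b]
          | mid =>
            refine (min_le_right _ _).trans ?_
            simp only [Function.comp, hdist, dist]
            linarith
        · refine le_trans (min_le_min le_rfl ?_) (hout (left a) u hu h)
          simp only [r, dist]
          linarith [dist_nonneg (l k) (r k)])
    -- After the first copy, the run goes to the second one.
    set S₁ := S ∪ Set.range (φ ∘ left) with hS₁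
    have hnotMem : ∀ x, (∀ a, x ≠ left a) → φ x ∉ S₁ := by
      rintro x hx (h | ⟨a, ha⟩)
      · exact hx _ ((hS x).1 h)
      · exact hx a (hinj ha).symm
    obtain ⟨q₂, hrun₂, hlen₂⟩ := WeightedGraph.exists_nnRun_insert hδ hδ' (S := S₁)
      (v := φ (left (last k))) (u := φ (right (l k))) (hnotMem _ (by simp)) (by
        intro u hu
        rw [hS₁, Set.mem_union, not_or] at hu
        by_cases h : u ∈ Set.range φ
        · obtain ⟨x, rfl⟩ := h
          cases x with
          | left b => exact absurd ⟨b, rfl⟩ hu.2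
          | right b =>
            simp only [hdist, dist, dist_self]
            linarith [dist_nonneg (l k) b]
          | mid =>
            simp only [hdist, dist, dist_self]
            linarith
        · refine le_trans (le_min ?_ ?_) (hout (left (last k)) u hu.1 h)
          · simp only [hdist, dist, dist_self, l]
            rw [dist_comm (last k) (l k)]
            linarith
          · simp only [hdist, dist, dist_self, r]
            linarith [dist_nonneg (l k) (r k)])
    obtain ⟨q₃, hrun₃, hlen₃⟩ :
        ∃ q : G.toSimpleGraph.Walk (φ (right (l k))) (φ (right (last k))),
          G.NNRun (insert (φ (right (l k))) S₁) q
            (insert (φ (right (l k))) S₁ ∪ Set.range (φ ∘ right)) ∧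
          G.length q = runLength k := ih (φ ∘ right) (insert (φ (right (l k))) S₁)
      (hinj.comp fun _ _ h => by injection h) (fun a b => hdist _ _)
      (fun a => by
        have h1 : φ (right a) ∉ S₁ := hnotMem _ (by simp)
        simp only [Set.mem_insert_iff, Function.comp, h1, or_false]
        exact ⟨fun h => by injection hinj h, fun h => by rw [h]⟩) (by
        intro a u hu hur
        rw [Set.mem_insert_iff, hS₁, Set.mem_union, not_or, not_or] at hu
        by_cases h : u ∈ Set.range φ
        · obtain ⟨x, rfl⟩ := h
          cases x with
          | left b => exact absurd ⟨b, rfl⟩ hu.2.2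
          | right b => exact absurd ⟨b, rfl⟩ hur
          | mid =>
            refine (min_le_left _ _).trans ?_
            simp only [Function.comp, hdist, dist]
            rw [dist_comm]
        · refine le_trans (min_le_min ?_ ?_) (hout (right a) u hu.2.1 h)
          · simp only [l, dist]
            rw [dist_comm a (l k)]
            linarith [dist_nonneg (l k) (r k)]
          · simp only [r, dist]
            linarith)
    -- After the second copy, only `mid` is left.
    set S₃ := insert (φ (right (l k))) S₁ ∪ Set.range (φ ∘ right) with hS₃
    obtain ⟨q₄, hrun₄, hlen₄⟩ := WeightedGraph.exists_nnRun_insert hδ hδ' (S := S₃)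
      (v := φ (right (last k))) (u := φ mid) (by
        rintro ((h | h) | ⟨a, ha⟩)
        · exact absurd (hinj h) (by simp)
        · exact hnotMem mid (by simp) h
        · exact absurd (hinj ha) (by simp)) (by
        intro u hu
        rw [hS₃, Set.mem_union, not_or, Set.mem_insert_iff, hS₁, Set.mem_union, not_or,
          not_or] at hu
        by_cases h : u ∈ Set.range φ
        · obtain ⟨x, rfl⟩ := h
          cases x with
          | left b => exact absurd ⟨b, rfl⟩ hu.1.2.2
          | right b => exact absurd ⟨b, rfl⟩ hu.2
          | mid => exact le_rfl
        · refine le_trans (le_min ?_ ?_) (hout (right (last k)) u hu.1.2.1 h)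
          · simp only [hdist, dist, l]
            linarith [dist_nonneg (l k) (r k), dist_comm (l k) (r k)]
          · simp only [hdist, dist, r]
            linarith)
    have hunion : insert (φ mid) S₃ = S ∪ Set.range φ := by
      ext u
      simp only [hS₃, hS₁, Set.mem_insert_iff, Set.mem_union, Set.mem_range, Function.comp]
      constructor
      · rintro (rfl | (rfl | h | ⟨a, rfl⟩) | ⟨a, rfl⟩)
        exacts [Or.inr ⟨_, rfl⟩, Or.inr ⟨_, rfl⟩, Or.inl h, Or.inr ⟨_, rfl⟩, Or.inr ⟨_, rfl⟩]
      · rintro (h | ⟨x, rfl⟩)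
        · exact Or.inr (Or.inl (Or.inr (Or.inl h)))
        · cases x with
          | left a => exact Or.inr (Or.inl (Or.inr (Or.inr ⟨a, rfl⟩)))
          | right a => exact Or.inr (Or.inr ⟨a, rfl⟩)
          | mid => exact Or.inl rfl
    refine ⟨((q₁.append q₂).append q₃).append q₄, ?_, ?_⟩
    · rw [← hunion]
      exact (((hrun₁.trans hrun₂).trans hrun₃).trans hrun₄)
    · simp only [WeightedGraph.length_append, hlen₁, hlen₂, hlen₃, hlen₄, hdist, dist, dist_self,
        runLength]
      ring

end SpikedVertex

namespace SpikedVertex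

theorem exists_nnRun_spikedPath (k : ℕ) :
    ∃ q : (spikedPath k).toSimpleGraph.Walk (l k) (last k),
      (spikedPath k).NNRun {l k} q Set.univ ∧ (spikedPath k).length q = runLength k := by
  obtain ⟨q, hq, hlen⟩ := exists_nnRun (fun u v => exists_length_eq_dist u v)
    (fun u v p => dist_le_length p) id {l k} Function.injective_id (fun _ _ => rfl)
    (fun _ => Iff.rfl) (fun _ u _ hu => absurd ⟨u, rfl⟩ hu)
  rw [Set.range_id, Set.union_univ] at hq
  exact ⟨q, hq, hlen⟩

theorem exists_isNNTour (k : ℕ) :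
    ∃ t : (spikedPath k).toSimpleGraph.Walk (l k) (l k), (spikedPath k).IsNNTour t ∧
      (spikedPath k).length t = runLength k + dist (l k) (last k) := by
  obtain ⟨q, hq, hqlen⟩ := exists_nnRun_spikedPath k
  obtain ⟨b, hb⟩ := exists_length_eq_dist (last k) (l k)
  refine ⟨q.append b, ⟨_, q, b, hq, fun b' => hb.trans_le (dist_le_length b'), rfl⟩, ?_⟩
  rw [WeightedGraph.length_append, hqlen, hb, dist_comm]

theorem runLength_add_dist (k : ℕ) :
    runLength (k + 1) + dist (l (k + 1)) (last (k + 1)) =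
      (((k + 1 : ℕ) : ℝ) + 2) * 2 ^ (k + 1) - 2 := by
  rw [runLength_succ, dist_l_last_succ]
  push_cast
  ring

end SpikedVertex

/-! ### Adding a vertex in front of the start -/

namespace WeightedGraph

variable {V : Type} {G : WeightedGraph V} {s : V}

/-- The edge lengths of the graph obtained from `G` by a new vertex `none`, joined to `s` by an edge
of length `1`. -/
def pendantWeight (G : WeightedGraph V) : Option V → Option V → ℝ
  | some u, some v => G.weight u v
  | _, _ => 1

/-- The adjacency of the graph obtained from `G` by a new vertex `none`, joined to `s`. -/
def PendantAdj (G : WeightedGraph V) (s : V) : Option V → Option V → Prop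
  | some u, some v => G.Adj u v
  | some u, none => u = s
  | none, some u => u = s
  | none, none => False

/-- The graph obtained from `G` by a new vertex `none`, joined to `s` by an edge of length `1`. -/
def pendant (G : WeightedGraph V) (s : V) : WeightedGraph (Option V) where
  Adj := G.PendantAdj s
  symm := ⟨by
    rintro (_ | u) (_ | v) h
    · exact h
    · exact h
    · exact h
    · exact G.symm.symm _ _ h⟩
  loopless := ⟨by
    rintro (_ | u) h
    · exact h
    · exact G.loopless.irrefl u h⟩
  weight := G.pendantWeight
  weight_symm := by
    rintro (_ | u) (_ | v)
    · rfl
    · rfl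
    · rfl
    · exact G.weight_symm u v
  weight_pos := by
    rintro (_ | u) (_ | v) h
    · exact one_pos
    · exact one_pos
    · exact one_pos
    · exact G.weight_pos u v h

theorem pendant_adj_none_some : (G.pendant s).Adj none (some s) := rfl

theorem pendant_adj_some_none : (G.pendant s).Adj (some s) none := rfl

@[simp] theorem pendant_weight_some (u v : V) :
    (G.pendant s).weight (some u) (some v) = G.weight u v := rfl

@[simp] theorem pendant_weight_none_some (u : V) : (G.pendant s).weight none (some u) = 1 := rfl

@[simp] theorem pendant_weight_some_none (u : V) : (G.pendant s).weight (some u) none = 1 := rfl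

/-- The inclusion of `G` in the graph with one vertex more. -/
def pendantHom (G : WeightedGraph V) (s : V) :
    G.toSimpleGraph →g (G.pendant s).toSimpleGraph where
  toFun := some
  map_rel' h := h

/-- The copy of a walk of `G` in the graph with one vertex more. -/
def pendantWalk {u v : V} (s : V) (p : G.toSimpleGraph.Walk u v) :
    (G.pendant s).toSimpleGraph.Walk (some u) (some v) :=
  p.map (G.pendantHom s)

@[simp] theorem length_pendantWalk {u v : V} (p : G.toSimpleGraph.Walk u v) :
    (G.pendant s).length (pendantWalk s p) = G.length p :=
  length_map (G.pendantHom s) (fun _ _ _ => rfl) p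

theorem pendantWalk_append {u v w : V} (p : G.toSimpleGraph.Walk u v)
    (q : G.toSimpleGraph.Walk v w) :
    pendantWalk s (p.append q) = (pendantWalk s p).append (pendantWalk s q) :=
  Walk.map_append _ _ _

theorem some_mem_support_pendantWalk {u v w : V} {p : G.toSimpleGraph.Walk u v}
    (hw : w ∈ p.support) : some w ∈ (pendantWalk s p).support := by
  have h := List.mem_map_of_mem (f := G.pendantHom s) hw
  rw [← Walk.support_map] at h
  exact h

/-- The contraction of the edge between `none` and `s` maps walks to walks. -/
theorem exists_length_add_le {x y : Option V} (p : (G.pendant s).toSimpleGraph.Walk x y) :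
    ∃ q : G.toSimpleGraph.Walk (x.getD s) (y.getD s),
      G.length q + (if x.isNone = y.isNone then 0 else 1) ≤ (G.pendant s).length p := by
  induction p with
  | nil => exact ⟨Walk.nil, by simp⟩
  | @cons a b c h p ih =>
    obtain ⟨q, hq⟩ := ih
    rw [length_cons]
    rcases a with _ | a <;> rcases b with _ | b
    · exact absurd h (by exact id)
    · obtain rfl : b = s := h
      refine ⟨q, ?_⟩
      rw [pendant_weight_none_some]
      split_ifs at hq ⊢ <;> linarith
    · obtain rfl : a = s := h
      refine ⟨q, ?_⟩
      rw [pendant_weight_some_none]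
      split_ifs at hq ⊢ <;> linarith
    · refine ⟨Walk.cons (show G.Adj a b from h) q, ?_⟩
      erw [length_cons]
      rw [pendant_weight_some]
      simp only [Option.isNone_some, Option.getD_some] at hq ⊢
      linarith

theorem exists_length_le_pendant {u v : V}
    (p : (G.pendant s).toSimpleGraph.Walk (some u) (some v)) :
    ∃ q : G.toSimpleGraph.Walk u v, G.length q ≤ (G.pendant s).length p := by
  obtain ⟨q, hq⟩ := exists_length_add_le p
  exact ⟨q, by simpa using hq⟩

theorem NNRun.pendant {S T : Set V} {v x : V} {q : G.toSimpleGraph.Walk v x}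
    (hq : G.NNRun S q T) (hv : v ∈ S) :
    (G.pendant s).NNRun (insert none (some '' S)) (pendantWalk s q) (insert none (some '' T)) := by
  induction hq with
  | done S v => exact NNRun.done _ _
  | @step S T v u x p q hp hq ih =>
    rw [pendantWalk_append]
    refine NNRun.step _ _ (isNearestStep_of_forall_length_le _ ?_ ?_) ?_
    · simpa using hp.1
    · rintro (_ | u') hu' p'
      · exact absurd (Set.mem_insert _ _) hu'
      · obtain ⟨q', hq'⟩ := exists_length_le_pendant p'
        rw [length_pendantWalk]
        exact (hp.length_le hv (by simpa using hu') q').trans hq'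
    · have h := ih (Set.mem_insert u S)
      rwa [Set.image_insert_eq, Set.insert_comm] at h

theorem exists_isNNTour_pendant {t : G.toSimpleGraph.Walk s s} (ht : G.IsNNTour t) :
    ∃ t' : (G.pendant s).toSimpleGraph.Walk none none, (G.pendant s).IsNNTour t' ∧
      (G.pendant s).length t' = G.length t + 2 := by
  obtain ⟨x, q, b, hq, hb, rfl⟩ := ht
  refine ⟨(Walk.cons pendant_adj_none_some (pendantWalk s q)).append
    ((pendantWalk s b).append (Walk.cons pendant_adj_some_none Walk.nil)),
    ⟨some x, _, _, ?_, ?_, rfl⟩, ?_⟩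
  · have h1 : (G.pendant s).IsNearestStep {none}
        (Walk.cons pendant_adj_none_some Walk.nil) := by
      refine isNearestStep_of_forall_length_le _ (by simp) ?_
      rintro (_ | u') hu' p'
      · exact absurd rfl hu'
      · obtain ⟨q', hq'⟩ := exists_length_add_le p'
        simp only [Option.isNone_none, Option.isNone_some, Bool.true_eq_false, if_false] at hq'
        rw [length_cons, length_nil, pendant_weight_none_some]
        linarith [length_nonneg q']
    have h2 := hq.pendant (s := s) (Set.mem_singleton s)
    have h3 : insert none (some '' ({s} : Set V)) = insert (some s) {none} := by
      rw [Set.image_singleton, Set.pair_comm]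
    have h4 : insert none (some '' (Set.univ : Set V)) = Set.univ := by
      ext (_ | v) <;> simp
    rw [h3, h4] at h2
    exact NNRun.step _ _ h1 h2
  · intro b'
    obtain ⟨q', hq'⟩ := exists_length_add_le b'
    simp only [Option.isNone_none, Option.isNone_some, Bool.false_eq_true, if_false] at hq'
    have := hb q'
    simp only [length_append, length_pendantWalk, length_cons, length_nil,
      pendant_weight_some_none]
    linarith
  · simp only [length_append, length_pendantWalk, length_cons, length_nil,
      pendant_weight_some_none, pendant_weight_none_some]
    ring

theorem exists_isTour_pendant {t : G.toSimpleGraph.Walk s s} (ht : G.IsTour t) :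
    ∃ t' : (G.pendant s).toSimpleGraph.Walk none none, (G.pendant s).IsTour t' ∧
      (G.pendant s).length t' = G.length t + 2 := by
  refine ⟨Walk.cons pendant_adj_none_some
    ((pendantWalk s t).append (Walk.cons pendant_adj_some_none Walk.nil)), ?_, ?_⟩
  · rintro (_ | v)
    · simp
    · simp [Walk.mem_support_append_iff, some_mem_support_pendantWalk (ht v)]
  · simp only [length_append, length_pendantWalk, length_cons, length_nil,
      pendant_weight_some_none, pendant_weight_none_some]
    ring

theorem connected_pendant (hG : G.toSimpleGraph.Connected) :
    (G.pendant s).toSimpleGraph.Connected := by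
  have h : ∀ x, (G.pendant s).toSimpleGraph.Reachable x none := by
    rintro (_ | v)
    · exact Reachable.refl _
    · obtain ⟨p⟩ := hG.preconnected v s
      exact ⟨(pendantWalk s p).append (Walk.cons pendant_adj_some_none Walk.nil)⟩
  exact ⟨fun x y => (h x).trans (h y).symm⟩

theorem HasCuts.pendant (hG : G.HasCuts) : (G.pendant s).HasCuts := by
  have hnone : ∀ a b, (G.pendant s).Adj a b → ¬((a = none) ↔ (b = none)) →
      s(a, b) = s(none, some s) := by
    rintro (_ | a) (_ | b) hab hne
    · simp at hne
    · obtain rfl : b = s := hab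
      rfl
    · obtain rfl : a = s := hab
      exact Sym2.eq_swap
    · simp at hne
  rintro (_ | u) (_ | v) huv
  · exact absurd huv (by exact id)
  · obtain rfl : v = s := huv
    exact ⟨(· = none), by simp, hnone⟩
  · obtain rfl : u = s := huv
    exact ⟨(· = none), by simp, fun a b hab hne => (hnone a b hab hne).trans Sym2.eq_swap⟩
  · obtain ⟨f, hf, hcut⟩ := hG u v huv
    refine ⟨fun x => f (x.getD s), hf, ?_⟩
    rintro (_ | a) (_ | b) hab hne
    · exact absurd Iff.rfl hne
    · obtain rfl : b = s := hab
      exact absurd Iff.rfl hne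
    · obtain rfl : a = s := hab
      exact absurd Iff.rfl hne
    · have := hcut a b hab hne
      simpa using this

end WeightedGraph

/-! ### The logarithmic lower bound -/

/-- Some tree with `n` vertices has a Nearest Neighbor tour of length `A` and a tour of length `B`
from the same vertex. That the graph is a tree is expressed by connectedness and `HasCuts`. -/
def HasTreeWithTours (n : ℕ) (A B : ℝ) : Prop :=
  ∃ (V : Type) (_ : Finite V) (G : WeightedGraph V) (s : V) (t p : G.toSimpleGraph.Walk s s),
    Nat.card V = n ∧ G.toSimpleGraph.Connected ∧ G.HasCuts ∧ G.IsNNTour t ∧ G.length t = A ∧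
      G.IsTour p ∧ G.length p = B

theorem HasTreeWithTours.succ {n : ℕ} {A B : ℝ} (h : HasTreeWithTours n A B) :
    HasTreeWithTours (n + 1) (A + 2) (B + 2) := by
  obtain ⟨V, _, G, s, t, p, hV, hconn, hcuts, ht, rfl, hp, rfl⟩ := h
  obtain ⟨t', ht', hlen⟩ := WeightedGraph.exists_isNNTour_pendant ht
  obtain ⟨p', hp', hlen'⟩ := WeightedGraph.exists_isTour_pendant hp
  exact ⟨Option V, inferInstance, G.pendant s, none, t', p', by rw [Finite.card_option, hV],
    WeightedGraph.connected_pendant hconn, hcuts.pendant, ht', hlen, hp', hlen'⟩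

theorem HasTreeWithTours.add {n : ℕ} {A B : ℝ} (h : HasTreeWithTours n A B) (m : ℕ) :
    HasTreeWithTours (n + m) (A + 2 * m) (B + 2 * m) := by
  induction m with
  | zero => simpa using h
  | succ m ih =>
    have := ih.succ
    push_cast
    rw [← add_assoc, show A + 2 * ((m : ℝ) + 1) = A + 2 * m + 2 by ring,
      show B + 2 * ((m : ℝ) + 1) = B + 2 * m + 2 by ring]
    exact this

theorem hasTreeWithTours_spikedPath (k : ℕ) :
    HasTreeWithTours (2 ^ (k + 1) - 1)
      (SpikedVertex.runLength k + SpikedVertex.dist (SpikedVertex.l k) (SpikedVertex.last k))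
      (6 * 2 ^ k - 2 * (k : ℝ) - 6) := by
  obtain ⟨t, ht, hlen⟩ := SpikedVertex.exists_isNNTour k
  obtain ⟨p, hp, hlen'⟩ := SpikedVertex.exists_isTour k
  exact ⟨SpikedVertex k, inferInstance, spikedPath k, _, t, p,
    Nat.eq_sub_of_add_eq (SpikedVertex.card_add_one k), SpikedVertex.connected k,
    SpikedVertex.hasCuts k, ht, hlen, hp, hlen'⟩

theorem HasTreeWithTours.le_nnCompetitiveRatioOnTrees {n : ℕ} {A B c : ℝ}
    (h : HasTreeWithTours n A B) (hB : 0 < B) (hc : 0 ≤ c) (hcA : c * B ≤ A) :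
    ENNReal.ofReal c ≤ nnCompetitiveRatioOnTrees n := by
  obtain ⟨V, _, G, s, t, p, hV, hconn, hcuts, ht, rfl, hp, rfl⟩ := h
  refine le_sInf fun c' hc' => ?_
  have h1 := hc' V G hV ⟨hconn, hcuts.isAcyclic⟩ s t ht
  have h2 : ENNReal.ofReal c * ENNReal.ofReal (G.length p) ≤
      c' * ENNReal.ofReal (G.length p) := by
    rw [← ENNReal.ofReal_mul hc]
    refine (ENNReal.ofReal_le_ofReal hcA).trans (h1.trans ?_)
    gcongr
    exact WeightedGraph.opt_le_length hp
  exact (ENNReal.mul_le_mul_iff_left (by simpa using hB) ENNReal.ofReal_ne_top).1 h2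

/-- If `n ≥ 2` and `2 ^ (k + 1) - 1 ≤ n < 2 ^ (k + 2) - 1`, then `G_k` with a path of
`m = n - (2 ^ (k + 1) - 1)` vertices in front of `l_k` has `n` vertices, a Nearest Neighbor tour of
length at least `(k + 1) * 2 ^ k`, and a tour of length at most `10 * 2 ^ k`. -/
theorem le_nnCompetitiveRatioOnTrees {n : ℕ} (hn : 2 ≤ n) :
    ENNReal.ofReal (1 / 20 * Real.log n) ≤ nnCompetitiveRatioOnTrees n := by
  obtain ⟨k, hk⟩ : ∃ k, Nat.log 2 (n + 1) = k + 1 :=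
    Nat.exists_eq_succ_of_ne_zero (Nat.log_pos one_lt_two (by omega)).ne'
  have hlow : 2 ^ (k + 1) ≤ n + 1 := by
    rw [← hk]; exact Nat.pow_log_le_self 2 (by omega)
  have hhigh : n + 1 < 2 ^ (k + 2) := by
    have := Nat.lt_pow_succ_log_self one_lt_two (n + 1)
    rwa [hk] at this
  obtain ⟨m, rfl⟩ : ∃ m, n = 2 ^ (k + 1) - 1 + m := Nat.exists_eq_add_of_le (by omega)
  have hpos : 1 ≤ 2 ^ (k + 1) := Nat.one_le_two_pow
  have hm : (m : ℝ) ≤ 2 * 2 ^ k := by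
    have : m < 2 ^ (k + 1) := by
      rw [pow_succ 2 (k + 1)] at hhigh
      omega
    have h := (Nat.cast_le (α := ℝ)).2 this.le
    push_cast at h
    rw [pow_succ] at h
    linarith
  have hlog : Real.log ((2 ^ (k + 1) - 1 + m : ℕ) : ℝ) ≤ ((k : ℝ) + 2) * Real.log 2 := by
    have h : ((2 ^ (k + 1) - 1 + m : ℕ) : ℝ) ≤ ((2 ^ (k + 2) : ℕ) : ℝ) :=
      Nat.cast_le.2 (by omega)
    have h0 : (0 : ℝ) < ((2 ^ (k + 1) - 1 + m : ℕ) : ℝ) := Nat.cast_pos.2 (by omega)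
    refine (Real.log_le_log h0 h).trans_eq ?_
    push_cast
    rw [Real.log_pow]
    push_cast
    ring
  have hlog0 : 0 ≤ Real.log ((2 ^ (k + 1) - 1 + m : ℕ) : ℝ) := Real.log_natCast_nonneg _
  have hk0 : (0 : ℝ) ≤ k := Nat.cast_nonneg k
  have hpow : (1 : ℝ) ≤ 2 ^ k := one_le_pow₀ one_le_two
  set L := Real.log ((2 ^ (k + 1) - 1 + m : ℕ) : ℝ)
  refine ((hasTreeWithTours_spikedPath k).add m).le_nnCompetitiveRatioOnTrees ?_
    (by linarith) ?_
  · have h1 : (k : ℝ) + 1 ≤ 2 ^ k := by exact_mod_cast Nat.lt_two_pow_self (n := k)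
    have h2 : (1 : ℝ) ≤ k + m := by
      have : 1 ≤ k + m := by
        rcases Nat.eq_zero_or_pos k with rfl | hk1 <;> omega
      exact_mod_cast this
    have hm0 : (0 : ℝ) ≤ m := Nat.cast_nonneg m
    linarith
  · have hB : 6 * 2 ^ k - 2 * (k : ℝ) - 6 + 2 * m ≤ 10 * 2 ^ k := by linarith
    have hA : ((k : ℝ) + 1) * 2 ^ k ≤ SpikedVertex.runLength k +
        SpikedVertex.dist (SpikedVertex.l k) (SpikedVertex.last k) + 2 * m := by
      cases k with
      | zero =>
        have : (1 : ℝ) ≤ m := by exact_mod_cast (show 1 ≤ m by omega)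
        simp [SpikedVertex.runLength, SpikedVertex.dist, SpikedVertex.l, SpikedVertex.last]
        linarith
      | succ k =>
        rw [SpikedVertex.runLength_add_dist, pow_succ]
        rw [pow_succ] at hpow
        push_cast
        have : (1 : ℝ) ≤ 2 ^ k := one_le_pow₀ one_le_two
        nlinarith
    have hlog2 := Real.log_two_lt_d9
    -- This needs `(k + 2) * log 2 ≤ 2 * (k + 1)`, which holds because `log 2 < 1`.
    have hL : 1 / 20 * L * 10 ≤ (k : ℝ) + 1 := by
      nlinarith
    calc 1 / 20 * L * (6 * 2 ^ k - 2 * (k : ℝ) - 6 + 2 * m)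
        ≤ 1 / 20 * L * (10 * 2 ^ k) := by gcongr
      _ = 1 / 20 * L * 10 * 2 ^ k := by ring
      _ ≤ ((k : ℝ) + 1) * 2 ^ k := by gcongr
      _ ≤ _ := hA

theorem mainTheorem1 :
    (∃ c C : ℝ, 0 < c ∧ 0 < C ∧ ∀ n : ℕ, 2 ≤ n →
      ENNReal.ofReal (c * Real.log n) ≤ nnCompetitiveRatioOnTrees n ∧
      nnCompetitiveRatioOnTrees n ≤ ENNReal.ofReal (C * Real.log n)) ∧
    (∀ k : ℕ, 1 ≤ k →
      (spikedPath k).toSimpleGraph.IsTree ∧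
      Nat.card (SpikedVertex k) = 2 ^ (k + 1) - 1 ∧
      (∃ t : (spikedPath k).toSimpleGraph.Walk (SpikedVertex.l k) (SpikedVertex.l k),
        (spikedPath k).IsNNTour t ∧
        (spikedPath k).length t = ((k : ℝ) + 2) * 2 ^ k - 2) ∧
      (spikedPath k).opt (SpikedVertex.l k) = 6 * 2 ^ k - 2 * (k : ℝ) - 6) := by
  refine ⟨⟨1 / 20, 4, by norm_num, by norm_num, fun n hn =>
    ⟨le_nnCompetitiveRatioOnTrees hn, nnCompetitiveRatioOnTrees_le hn⟩⟩, fun k hk => ?_⟩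
  obtain ⟨k, rfl⟩ := Nat.exists_eq_add_of_le' hk
  obtain ⟨t, ht, hlen⟩ := SpikedVertex.exists_isNNTour (k + 1)
  exact ⟨SpikedVertex.isTree _, Nat.eq_sub_of_add_eq (SpikedVertex.card_add_one _),
    ⟨t, ht, hlen.trans (SpikedVertex.runLength_add_dist k)⟩, SpikedVertex.opt_spikedPath _⟩
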